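/- **Theorem 1 (Upper bound for CMCB-FI).** Let $d\ge 1$, let $\triangle_d$ be the probability simplex in $\mathbb R^d$ and let $\rho>0$. Let $\nu$ be a probability distribution on $\mathbb R^d$ with mean $\theta^*$ and covariance matrix $\Sigma^*$ such that $\Sigma^*_{ii}\le 1$ for all $i$ and, for $X\sim\nu$, $\mathbb E[\exp(u^\top (X-\theta^*))]\le \exp(\tfrac12 u^\top\Sigma^* u)$ for all $u\in\mathbb R^d$. Put $f(w)=w^\top\theta^*-\rho\, w^\top\Sigma^* w$, let $w^*\in\arg\max_{w\in\triangle_d} f(w)$, and put $\theta^*_{\max}=\max_i\theta^*_i$, $\theta^*_{\min}=\min_i\theta^*_i$, $\Sigma^*_{\max}=\max_i\Sigma^*_{ii}$ and $\Delta_{\max}=\max_{w\in\triangle_d}(f(w^*)-f(w))$. Let $\theta_1,\theta_2,\dots$ be independent random vectors with law $\nu$, with $\theta_t$ observed after round $t$. The algorithm MC-Empirical plays $w_1=(\frac1d,\dots,\frac1d)$ and, for $t\ge 2$, plays $w_t\in\arg\max_{w\in\triangle_d}\big(w^\top\hat\theta_{t-1}-\rho\, w^\top\hat\Sigma_{t-1}w\big)$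 (ties broken in any measurable way), where $\hat\theta_{t}=\frac1t\sum_{s\le t}\theta_s$ and $\hat\Sigma_{t}=\frac1t\sum_{s\le t}(\theta_s-\hat\theta_t)(\theta_s-\hat\theta_t)^\top$. Its expected regret is $\mathbb E[\mathcal R(T)]=\sum_{t=1}^T\mathbb E[f(w^*)-f(w_t)]$. There is an absolute constant $C>0$ such that the following hold. (a) For all $d$, $\rho$ and $G$ there is $T_0$, depending only on $d,\rho,G$, such that for all such $\nu$ with $\theta^*_{\max}-\theta^*_{\min}\le G$ and all $T\ge T_0$, $$\mathbb E[\mathcal R(T)]\le C\Big(\min\Big\{\sqrt{{w^*}^\top\Sigma^*w^*}+\rho^{-1/2}\sqrt{\theta^*_{\max}-\theta^*_{\min}},\ \sqrt{\Sigma^*_{\max}}\Big\}+\rho\Big)\ln T\,\sqrt T .$$ (b) There are constants $K_d$, depending only on $d$, such that for all $d,\rho,\nu$ as above and every horizon $T\ge 1$, $$\mathbb E[\mathcal R(T)]\le C\Big(\min\Big\{\sqrt{{w^*}^\top\Sigma^*w^*}+\rho^{-1/2}\sqrt{\theta^*_{\max}-\theta^*_{\min}}+\varepsilon_T,\ \sqrt{\Sigma^*_{\max}}\Big\}+\rho\Big)\ln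 T\,\sqrt T+K_d\,\Delta_{\max},$$ where $\varepsilon_T=T^{-1/4}(\rho^{-1/2}+1)+\dfrac{\ln T}{\rho\sqrt T}$. -/

import Mathlib

open MeasureTheory ProbabilityTheory
open scoped Matrix

namespace CMCB

noncomputable section

/-- The mean-covariance objective `w ↦ wᵀ m - ρ wᵀ S w`. -/
def meanCov {d : ℕ} (m : Fin d → ℝ) (S : Matrix (Fin d) (Fin d) ℝ) (ρ : ℝ)
    (w : Fin d → ℝ) : ℝ :=
  w ⬝ᵥ m - ρ * (w ⬝ᵥ (S *ᵥ w))

/-- `w` is an argmax over the probability simplex of the mean-covariance objective. -/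
def IsArgmax {d : ℕ} (m : Fin d → ℝ) (S : Matrix (Fin d) (Fin d) ℝ) (ρ : ℝ)
    (w : Fin d → ℝ) : Prop :=
  w ∈ stdSimplex ℝ (Fin d) ∧ IsMaxOn (meanCov m S ρ) (stdSimplex ℝ (Fin d)) w

/-- The mean vector of a joint reward distribution `ν` on `ℝ^d`. -/
def mean {d : ℕ} (ν : Measure (Fin d → ℝ)) : Fin d → ℝ :=
  fun i => ∫ x, x i ∂ν

/-- The covariance matrix of a joint reward distribution `ν` on `ℝ^d`. -/
def covMat {d : ℕ} (ν : Measure (Fin d → ℝ)) : Matrix (Fin d) (Fin d) ℝ :=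
  Matrix.of fun i j => cov[fun x : Fin d → ℝ => x i, fun x : Fin d → ℝ => x j; ν]

/-- The standing assumptions on the joint reward distribution: the variances are at most one, and
the centered reward vector is sub-Gaussian with respect to its own covariance matrix. -/
structure IsRewardLaw {d : ℕ} (ν : Measure (Fin d → ℝ)) : Prop where
  prob : IsProbabilityMeasure ν
  var_le_one : ∀ i, covMat ν i i ≤ 1
  integrable_exp : ∀ u : Fin d → ℝ, Integrable (fun x => Real.exp (u ⬝ᵥ (x - mean ν))) ν
  subGaussian : ∀ u : Fin d → ℝ,
    ∫ x, Real.exp (u ⬝ᵥ (x - mean ν)) ∂ν ≤ Real.exp ((1 / 2) * (u ⬝ᵥ (covMat ν *ᵥ u)))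

/-- Empirical mean of the first `n` samples `x 0, …, x (n - 1)`. -/
def empMean {d : ℕ} (x : ℕ → Fin d → ℝ) (n : ℕ) : Fin d → ℝ :=
  fun i => (1 / (n : ℝ)) * ∑ s ∈ Finset.range n, x s i

/-- Empirical covariance matrix of the first `n` samples, centered at their empirical mean. -/
def empCov {d : ℕ} (x : ℕ → Fin d → ℝ) (n : ℕ) : Matrix (Fin d) (Fin d) ℝ :=
  Matrix.of fun i j =>
    (1 / (n : ℝ)) * ∑ s ∈ Finset.range n, (x s i - empMean x n i) * (x s j - empMean x n j)

/-- The full-information environment: the reward vectors `θ 0, θ 1, …` of the successive rounds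
are independent with common law `ν`. Rounds are counted from `0`. -/
structure IsEnvironment {d : ℕ} {Ω : Type*} [MeasurableSpace Ω] (P : Measure Ω)
    (ν : Measure (Fin d → ℝ)) (θ : ℕ → Ω → Fin d → ℝ) : Prop where
  law : ∀ t, HasLaw (θ t) ν P
  indep : iIndepFun θ P

/-- `w 0, w 1, …` are actions chosen by the empirical maximization algorithm: the uniform weights
in the first round, and in every later round `t` a maximizer over the simplex of the empirical
mean-covariance objective of the reward vectors of the `t` earlier rounds. Ties may be broken in
any (measurable) way. -/
structure IsMCEmpirical {d : ℕ} {Ω : Type*} [MeasurableSpace Ω] (ρ : ℝ)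
    (θ : ℕ → Ω → Fin d → ℝ) (w : ℕ → Ω → Fin d → ℝ) : Prop where
  measurable : ∀ t, Measurable (w t)
  first : ∀ ω, w 0 ω = fun _ => 1 / (d : ℝ)
  argmax : ∀ t, 1 ≤ t → ∀ ω,
    IsArgmax (empMean (fun s => θ s ω) t) (empCov (fun s => θ s ω) t) ρ (w t ω)

/-- Expected cumulative regret, over the first `T` rounds, of the actions `w` against `wstar`. -/
def expectedRegret {d : ℕ} {Ω : Type*} [MeasurableSpace Ω] (P : Measure Ω)
    (ν : Measure (Fin d → ℝ)) (ρ : ℝ) (wstar : Fin d → ℝ) (w : ℕ → Ω → Fin d → ℝ) (T : ℕ) : ℝ :=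
  ∑ t ∈ Finset.range T,
    ∫ ω, (meanCov (mean ν) (covMat ν) ρ wstar - meanCov (mean ν) (covMat ν) ρ (w t ω)) ∂P

/-- `θ*_max - θ*_min`. -/
def meanGap {d : ℕ} (ν : Measure (Fin d → ℝ)) : ℝ :=
  (⨆ i, mean ν i) - ⨅ i, mean ν i

/-- `Σ*_max`, the largest diagonal entry of the covariance matrix. -/
def varMax {d : ℕ} (ν : Measure (Fin d → ℝ)) : ℝ :=
  ⨆ i, covMat ν i i

/-- The risk `wᵀ Σ* w`. -/
def risk {d : ℕ} (ν : Measure (Fin d → ℝ)) (w : Fin d → ℝ) : ℝ :=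
  w ⬝ᵥ (covMat ν *ᵥ w)

/-- The largest possible one-round regret over the simplex. -/
def maxRegret {d : ℕ} (ν : Measure (Fin d → ℝ)) (ρ : ℝ) (wstar : Fin d → ℝ) : ℝ :=
  sSup ((fun w => meanCov (mean ν) (covMat ν) ρ wstar - meanCov (mean ν) (covMat ν) ρ w) ''
    stdSimplex ℝ (Fin d))

end

end CMCB

universe u

namespace CMCB

/-! ### Elementary sums -/

theorem sum_inv_sqrt_le (n : ℕ) :
    ∑ t ∈ Finset.range n, 1 / √((t : ℝ) + 1) ≤ 2 * √n := by
  induction n with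
  | zero => simp
  | succ n ih =>
    rw [Finset.sum_range_succ]
    push_cast
    have hq : 0 < √((n : ℝ) + 1) := by positivity
    have hp : 0 ≤ √(n : ℝ) := by positivity
    have h1 : √((n : ℝ) + 1) ^ 2 = n + 1 := Real.sq_sqrt (by positivity)
    have h2 : √(n : ℝ) ^ 2 = n := Real.sq_sqrt (by positivity)
    have : 1 / √((n : ℝ) + 1) ≤ 2 * √((n : ℝ) + 1) - 2 * √n := by
      rw [div_le_iff₀ hq]
      nlinarith [sq_nonneg (√((n : ℝ) + 1) - √n)]
    linarith

theorem sum_inv_sqrt_mul_sqrt_sqrt_le (n : ℕ) :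
    ∑ t ∈ Finset.range n, 1 / (√((t : ℝ) + 1) * √√((t : ℝ) + 1)) ≤ 4 * √√n := by
  induction n with
  | zero => simp
  | succ n ih =>
    rw [Finset.sum_range_succ]
    push_cast
    have h1 : √((n : ℝ) + 1) ^ 2 = n + 1 := Real.sq_sqrt (by positivity)
    have h2 : √(n : ℝ) ^ 2 = n := Real.sq_sqrt (by positivity)
    have h3 : √√((n : ℝ) + 1) ^ 2 = √((n : ℝ) + 1) := Real.sq_sqrt (by positivity)
    have h4 : √√(n : ℝ) ^ 2 = √n := Real.sq_sqrt (by positivity)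
    have hq : 0 < √√((n : ℝ) + 1) := by positivity
    have hp : 0 ≤ √√(n : ℝ) := by positivity
    have hpq : √√(n : ℝ) ≤ √√((n : ℝ) + 1) := by gcongr; linarith
    set p := √√(n : ℝ)
    set q := √√((n : ℝ) + 1)
    rw [← h3] at h1 ⊢
    rw [← h4] at h2
    have : 1 / (q ^ 2 * q) ≤ 4 * (q - p) := by
      rw [div_le_iff₀ (by positivity)]
      have e : 1 = (q - p) * ((q + p) * (q ^ 2 + p ^ 2)) := by linarith
      have : (q + p) * (q ^ 2 + p ^ 2) ≤ (2 * q) * (2 * q ^ 2) := by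
        gcongr <;> nlinarith
      nlinarith [mul_le_mul_of_nonneg_left this (sub_nonneg.2 hpq)]
    linarith

theorem sum_inv_le (n : ℕ) :
    ∑ t ∈ Finset.range n, 1 / ((t : ℝ) + 1) ≤ 1 + Real.log n := by
  have h := harmonic_le_one_add_log n
  rw [harmonic] at h
  push_cast at h
  simpa using h

/-! ### Moments of the reward law -/

variable {d : ℕ} {ν : Measure (Fin d → ℝ)}

theorem IsRewardLaw.fourth_moment (hν : IsRewardLaw ν) (i : Fin d) :
    Integrable (fun x => (x i - mean ν i) ^ 4) ν ∧ ∫ x, (x i - mean ν i) ^ 4 ∂ν ≤ 96 := by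
  have hp := hν.prob
  have h1 := hν.integrable_exp (Pi.single i 1)
  have h2 := hν.integrable_exp (Pi.single i (-1))
  have s1 := hν.subGaussian (Pi.single i 1)
  have s2 := hν.subGaussian (Pi.single i (-1))
  have hv := hν.var_le_one i
  simp only [single_dotProduct, Pi.sub_apply, one_mul, Matrix.mulVec_single,
    MulOpposite.op_one, one_smul, Matrix.col_apply, MulOpposite.op_neg, neg_smul, Pi.neg_apply,
    mul_neg, neg_mul, neg_neg] at h1 h2 s1 s2
  have hle : ∀ x : Fin d → ℝ, (x i - mean ν i) ^ 4 ≤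
      24 * (Real.exp (x i - mean ν i) + Real.exp (-(x i - mean ν i))) := by
    intro x
    set y := x i - mean ν i
    have h := Real.pow_div_factorial_le_exp |y| (abs_nonneg y) 4
    have h4 : |y| ^ 4 = y ^ 4 := by
      rw [show 4 = 2 * 2 from rfl, pow_mul, pow_mul, sq_abs]
    have h' : Real.exp |y| ≤ Real.exp y + Real.exp (-y) := by
      rcases abs_cases y with ⟨h, _⟩ | ⟨h, _⟩ <;> rw [h] <;>
        linarith [Real.exp_pos y, Real.exp_pos (-y)]
    rw [h4, show (Nat.factorial 4 : ℝ) = 24 by norm_num [Nat.factorial]] at h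
    linarith
  have hint : Integrable (fun x : Fin d → ℝ => 24 * (Real.exp (x i - mean ν i) +
      Real.exp (-(x i - mean ν i)))) ν := (h1.add h2).const_mul 24
  have hI : Integrable (fun x => (x i - mean ν i) ^ 4) ν := by
    refine hint.mono' (Measurable.aestronglyMeasurable (by fun_prop)) (ae_of_all _ fun x => ?_)
    rw [Real.norm_of_nonneg (by positivity)]
    exact hle x
  refine ⟨hI, (integral_mono hI hint hle).trans ?_⟩
  rw [integral_const_mul, integral_add h1 h2]
  have he : Real.exp (1 / 2 * covMat ν i i) ≤ 2 := by
    have h : Real.exp (1 / 2 * covMat ν i i) ≤ Real.exp (1 / 2) :=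
      Real.exp_le_exp.2 (by linarith)
    have h2 : Real.exp (1 / 2) ^ 2 = Real.exp 1 := by rw [← Real.exp_nat_mul]; norm_num
    nlinarith [Real.exp_one_lt_d9, Real.exp_pos (1 / 2)]
  linarith

theorem IsRewardLaw.memLp_coord (hν : IsRewardLaw ν) (i : Fin d) :
    MemLp (fun x : Fin d → ℝ => x i - mean ν i) 2 ν := by
  have hp := hν.prob
  rw [memLp_two_iff_integrable_sq (Measurable.aestronglyMeasurable (by fun_prop))]
  refine ((hν.fourth_moment i).1.add (integrable_const (1 : ℝ))).mono'
    (Measurable.aestronglyMeasurable (by fun_prop)) (ae_of_all _ fun x => ?_)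
  rw [Real.norm_of_nonneg (by positivity)]
  simp only [Pi.add_apply]
  nlinarith [sq_nonneg ((x i - mean ν i) ^ 2 - 1)]

theorem IsRewardLaw.integral_coord (hν : IsRewardLaw ν) (i : Fin d) :
    ∫ x, (x i - mean ν i) ∂ν = 0 := by
  have hp := hν.prob
  have h := ((hν.memLp_coord i).integrable one_le_two).add (integrable_const (mean ν i))
  simp only [Pi.add_def, sub_add_cancel] at h
  rw [integral_sub h (integrable_const _)]
  simp [mean]

theorem IsRewardLaw.integrable_mul (hν : IsRewardLaw ν) (i j : Fin d) :
    Integrable (fun x => (x i - mean ν i) * (x j - mean ν j)) ν :=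
  (hν.memLp_coord i).integrable_mul (hν.memLp_coord j)

theorem integral_mul_eq_covMat (i j : Fin d) :
    ∫ x, (x i - mean ν i) * (x j - mean ν j) ∂ν = covMat ν i j := rfl

theorem IsRewardLaw.memLp_mul (hν : IsRewardLaw ν) (i j : Fin d) :
    MemLp (fun x : Fin d → ℝ => (x i - mean ν i) * (x j - mean ν j)) 2 ν := by
  rw [memLp_two_iff_integrable_sq (Measurable.aestronglyMeasurable (by fun_prop))]
  refine ((hν.fourth_moment i).1.add (hν.fourth_moment j).1).mono'
    (Measurable.aestronglyMeasurable (by fun_prop)) (ae_of_all _ fun x => ?_)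
  rw [Real.norm_of_nonneg (by positivity)]
  simp only [Pi.add_apply]
  nlinarith [sq_nonneg ((x i - mean ν i) ^ 2 - (x j - mean ν j) ^ 2),
    sq_nonneg ((x i - mean ν i) ^ 2), sq_nonneg ((x j - mean ν j) ^ 2)]

theorem IsRewardLaw.integral_sq_mul_sub_le (hν : IsRewardLaw ν) (i j : Fin d) :
    ∫ x, ((x i - mean ν i) * (x j - mean ν j) - covMat ν i j) ^ 2 ∂ν ≤ 96 := by
  have hp := hν.prob
  have h1 : ∫ x, ((x i - mean ν i) * (x j - mean ν j) - covMat ν i j) ^ 2 ∂ν ≤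
      ∫ x, ((x i - mean ν i) * (x j - mean ν j)) ^ 2 ∂ν := by
    have h := variance_le_expectation_sq (hν.memLp_mul i j).aestronglyMeasurable
    rw [variance_eq_integral (hν.memLp_mul i j).aemeasurable] at h
    exact h
  have h2 : ∫ x, ((x i - mean ν i) * (x j - mean ν j)) ^ 2 ∂ν ≤
      ∫ x, (((x i - mean ν i) ^ 4) / 2 + ((x j - mean ν j) ^ 4) / 2) ∂ν := by
    refine integral_mono (hν.memLp_mul i j).integrable_sq
      (((hν.fourth_moment i).1.div_const 2).add ((hν.fourth_moment j).1.div_const 2)) fun x => ?_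
    simp only
    nlinarith [sq_nonneg ((x i - mean ν i) ^ 2 - (x j - mean ν j) ^ 2)]
  rw [integral_add ((hν.fourth_moment i).1.div_const 2) ((hν.fourth_moment j).1.div_const 2),
    integral_div, integral_div] at h2
  linarith [(hν.fourth_moment i).2, (hν.fourth_moment j).2]

theorem IsRewardLaw.memLp_dotProduct (hν : IsRewardLaw ν) (u : Fin d → ℝ) :
    MemLp (fun x => u ⬝ᵥ (x - mean ν)) 2 ν := by
  simp only [dotProduct, Pi.sub_apply]
  exact memLp_finsetSum _ fun i _ => (hν.memLp_coord i).const_mul (u i)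

theorem IsRewardLaw.integral_dotProduct (hν : IsRewardLaw ν) (u : Fin d → ℝ) :
    ∫ x, u ⬝ᵥ (x - mean ν) ∂ν = 0 := by
  have hp := hν.prob
  simp only [dotProduct, Pi.sub_apply]
  rw [integral_finsetSum _ fun i _ => ((hν.memLp_coord i).integrable one_le_two).const_mul (u i)]
  simp [integral_const_mul, hν.integral_coord]

theorem IsRewardLaw.integral_dotProduct_sq (hν : IsRewardLaw ν) (u : Fin d → ℝ) :
    ∫ x, (u ⬝ᵥ (x - mean ν)) ^ 2 ∂ν = risk ν u := by
  have h : ∀ x : Fin d → ℝ, (u ⬝ᵥ (x - mean ν)) ^ 2 =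
      ∑ i, ∑ j, u i * u j * ((x i - mean ν i) * (x j - mean ν j)) := by
    intro x
    simp only [dotProduct, Pi.sub_apply, sq, Finset.sum_mul_sum]
    exact Finset.sum_congr rfl fun i _ => Finset.sum_congr rfl fun j _ => by ring
  simp only [h]
  rw [integral_finsetSum _ fun i _ => integrable_finsetSum _ fun j _ =>
    (hν.integrable_mul i j).const_mul _]
  simp only [risk, dotProduct, Matrix.mulVec, Finset.mul_sum]
  refine Finset.sum_congr rfl fun i _ => ?_
  rw [integral_finsetSum _ fun j _ => (hν.integrable_mul i j).const_mul _]
  refine Finset.sum_congr rfl fun j _ => ?_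
  rw [integral_const_mul, integral_mul_eq_covMat]
  ring

theorem IsRewardLaw.risk_nonneg (hν : IsRewardLaw ν) (u : Fin d → ℝ) : 0 ≤ risk ν u := by
  rw [← hν.integral_dotProduct_sq]
  exact integral_nonneg fun _ => sq_nonneg _

theorem le_varMax (i : Fin d) : covMat ν i i ≤ varMax ν :=
  le_ciSup (f := fun i => covMat ν i i) (Set.finite_range _).bddAbove i

theorem IsRewardLaw.risk_le_varMax (hν : IsRewardLaw ν) {w : Fin d → ℝ}
    (hw : w ∈ stdSimplex ℝ (Fin d)) : risk ν w ≤ varMax ν := by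
  have hsq : ∀ i, Integrable (fun x : Fin d → ℝ => (x i - mean ν i) ^ 2) ν :=
    fun i => (hν.memLp_coord i).integrable_sq
  calc risk ν w = ∫ x, (w ⬝ᵥ (x - mean ν)) ^ 2 ∂ν := (hν.integral_dotProduct_sq w).symm
    _ ≤ ∫ x, ∑ i, w i * (x i - mean ν i) ^ 2 ∂ν := by
      refine integral_mono (hν.memLp_dotProduct w).integrable_sq
        (integrable_finsetSum _ fun i _ => (hsq i).const_mul _) fun x => ?_
      exact Real.pow_arith_mean_le_arith_mean_pow_of_even Finset.univ w (fun i => x i - mean ν i)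
        (fun i _ => hw.1 i) hw.2 even_two
    _ = ∑ i, w i * covMat ν i i := by
      rw [integral_finsetSum _ fun i _ => (hsq i).const_mul _]
      refine Finset.sum_congr rfl fun i _ => ?_
      rw [integral_const_mul, ← integral_mul_eq_covMat]
      simp only [sq]
    _ ≤ ∑ i, w i * varMax ν := by
      gcongr with i
      · exact hw.1 i
      · exact le_varMax i
    _ = varMax ν := by rw [← Finset.sum_mul, hw.2, one_mul]

theorem IsRewardLaw.varMax_le_one [NeZero d] (hν : IsRewardLaw ν) : varMax ν ≤ 1 :=
  ciSup_le hν.var_le_one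

end CMCB

namespace CMCB

/-! ### Spectral resolution of the risk -/

variable {d : ℕ} {ν : Measure (Fin d → ℝ)}

theorem covMat_isHermitian : (covMat ν).IsHermitian := by
  ext i j
  simp [covMat, covariance_comm]

theorem exists_spectral_resolution {S : Matrix (Fin d) (Fin d) ℝ} (hS : S.IsHermitian) :
    ∃ v : Fin d → Fin d → ℝ,
      (∀ w e : Fin d → ℝ, w ⬝ᵥ e = ∑ k, (w ⬝ᵥ v k) * (v k ⬝ᵥ e)) ∧
      ∀ w : Fin d → ℝ, w ⬝ᵥ (S *ᵥ w) = ∑ k, (v k ⬝ᵥ (S *ᵥ v k)) * (w ⬝ᵥ v k) ^ 2 := by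
  set b := hS.eigenvectorBasis with hb
  have hin : ∀ x y : EuclideanSpace ℝ (Fin d), inner ℝ x y = (x : Fin d → ℝ) ⬝ᵥ y := by
    intro x y
    rw [EuclideanSpace.inner_eq_star_dotProduct, dotProduct_comm]
    simp
  have hvv : ∀ k, (b k : Fin d → ℝ) ⬝ᵥ b k = 1 := by
    intro k
    rw [← hin, real_inner_self_eq_norm_sq, b.orthonormal.1 k, one_pow]
  have hres : ∀ w e : Fin d → ℝ,
      w ⬝ᵥ e = ∑ k, (w ⬝ᵥ (b k : Fin d → ℝ)) * ((b k : Fin d → ℝ) ⬝ᵥ e) := by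
    intro w e
    have h := b.sum_inner_mul_inner (WithLp.toLp 2 w) (WithLp.toLp 2 e)
    simp only [hin] at h
    exact h.symm
  have hmul : ∀ k, S *ᵥ (b k : Fin d → ℝ) = hS.eigenvalues k • (b k : Fin d → ℝ) :=
    hS.mulVec_eigenvectorBasis
  refine ⟨fun k => b k, hres, fun w => ?_⟩
  rw [hres w (S *ᵥ w)]
  refine Finset.sum_congr rfl fun k _ => ?_
  have hsymm : (b k : Fin d → ℝ) ⬝ᵥ (S *ᵥ w) = (S *ᵥ (b k : Fin d → ℝ)) ⬝ᵥ w := by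
    have hT : Sᵀ = S := by simpa [Matrix.IsHermitian] using hS
    rw [Matrix.dotProduct_mulVec, ← Matrix.mulVec_transpose, hT]
  rw [hsymm, hmul, dotProduct_smul, smul_dotProduct, hvv, dotProduct_comm _ w]
  simp only [smul_eq_mul]
  ring

/-! ### Empirical averages -/

variable {Ω : Type*} [MeasurableSpace Ω] {P : Measure Ω} [IsProbabilityMeasure P]
  {θ : ℕ → Ω → Fin d → ℝ}

theorem IsEnvironment.average_sq (hE : IsEnvironment P ν θ) {g : (Fin d → ℝ) → ℝ}
    (hgm : Measurable g) (hg : MemLp g 2 ν) (h0 : ∫ x, g x ∂ν = 0) {n : ℕ} (hn : 1 ≤ n) :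
    MemLp (fun ω => (1 / (n : ℝ)) * ∑ s ∈ Finset.range n, g (θ s ω)) 2 P ∧
      ∫ ω, ((1 / (n : ℝ)) * ∑ s ∈ Finset.range n, g (θ s ω)) ^ 2 ∂P =
        (1 / (n : ℝ)) * ∫ x, g x ^ 2 ∂ν := by
  have hX : ∀ s, MemLp (fun ω => g (θ s ω)) 2 P := by
    intro s
    have h := hg
    rw [← (hE.law s).map_eq] at h
    exact h.comp_of_map (hE.law s).aemeasurable
  have hint : ∀ s, ∫ ω, g (θ s ω) ∂P = 0 := by
    intro s
    have h := (hE.law s).integral_comp (f := g) hg.aestronglyMeasurable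
    rw [← h0, ← h]
    rfl
  have hint2 : ∀ s, ∫ ω, g (θ s ω) ^ 2 ∂P = ∫ x, g x ^ 2 ∂ν := by
    intro s
    exact (hE.law s).integral_comp (f := fun x => g x ^ 2) (hg.aestronglyMeasurable.pow 2)
  have hind : iIndepFun (fun s ω => g (θ s ω)) P := hE.indep.comp (fun _ => g) fun _ => hgm
  have hS : MemLp (∑ s ∈ Finset.range n, fun ω => g (θ s ω)) 2 P :=
    memLp_finsetSum' _ fun s _ => hX s
  have hvar := IndepFun.variance_sum (s := Finset.range n) (fun s _ => hX s)
    fun i _ j _ hij => hind.indepFun hij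
  have hv : ∀ s, Var[fun ω => g (θ s ω); P] = ∫ x, g x ^ 2 ∂ν := by
    intro s
    rw [variance_of_integral_eq_zero (hX s).aemeasurable (hint s), hint2 s]
  have hS0 : ∫ ω, (∑ s ∈ Finset.range n, fun ω => g (θ s ω)) ω ∂P = 0 := by
    simp only [Finset.sum_apply]
    rw [integral_finsetSum _ fun s _ => (hX s).integrable one_le_two]
    simp [hint]
  rw [variance_of_integral_eq_zero hS.aemeasurable hS0] at hvar
  simp only [hv, Finset.sum_const, Finset.card_range, nsmul_eq_mul, Finset.sum_apply] at hvar
  constructor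
  · have h := hS.const_mul (1 / (n : ℝ))
    simpa only [Finset.sum_apply] using h
  · simp only [mul_pow]
    rw [integral_const_mul, hvar]
    have : (n : ℝ) ≠ 0 := by positivity
    field_simp

theorem dotProduct_empMean_sub (x : ℕ → Fin d → ℝ) (m u : Fin d → ℝ) {n : ℕ} (hn : 1 ≤ n) :
    u ⬝ᵥ (empMean x n - m) = (1 / (n : ℝ)) * ∑ s ∈ Finset.range n, u ⬝ᵥ (x s - m) := by
  have : (n : ℝ) ≠ 0 := by positivity
  simp only [dotProduct, Pi.sub_apply, empMean, Finset.mul_sum]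
  rw [Finset.sum_comm]
  refine Finset.sum_congr rfl fun i _ => ?_
  simp only [← Finset.mul_sum, Finset.sum_sub_distrib, Finset.sum_const, Finset.card_range,
    nsmul_eq_mul]
  field_simp

theorem IsEnvironment.dotProduct_empMean (hE : IsEnvironment P ν θ) (hν : IsRewardLaw ν)
    (u : Fin d → ℝ) {n : ℕ} (hn : 1 ≤ n) :
    MemLp (fun ω => u ⬝ᵥ (empMean (fun s => θ s ω) n - mean ν)) 2 P ∧
      ∫ ω, (u ⬝ᵥ (empMean (fun s => θ s ω) n - mean ν)) ^ 2 ∂P = risk ν u / n := by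
  have h := hE.average_sq (g := fun x => u ⬝ᵥ (x - mean ν))
    (by simp only [dotProduct, Pi.sub_apply]; fun_prop)
    (hν.memLp_dotProduct u) (hν.integral_dotProduct u) hn
  simp only [dotProduct_empMean_sub _ _ _ hn]
  refine ⟨h.1, ?_⟩
  rw [h.2, hν.integral_dotProduct_sq]
  ring

/-- The estimation error of the mean, measured against the risk. -/
theorem IsEnvironment.exists_mean_error (hE : IsEnvironment P ν θ) (hν : IsRewardLaw ν)
    {n : ℕ} (hn : 1 ≤ n) :
    ∃ N : Ω → ℝ, (∀ ω, 0 ≤ N ω) ∧ MemLp N 2 P ∧ ∫ ω, N ω ^ 2 ∂P ≤ d / n ∧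
      ∀ᵐ ω ∂P, ∀ u : Fin d → ℝ,
        |u ⬝ᵥ (empMean (fun s => θ s ω) n - mean ν)| ≤ √(risk ν u) * N ω := by
  obtain ⟨v, hv, hvS⟩ := exists_spectral_resolution (covMat_isHermitian (ν := ν))
  change ∀ w, risk ν w = ∑ k, risk ν (v k) * _ at hvS
  set e : Ω → Fin d → ℝ := fun ω => empMean (fun s => θ s ω) n - mean ν with he
  have hmom := fun k => hE.dotProduct_empMean hν (v k) hn
  have hint : ∀ k, Integrable (fun ω => (v k ⬝ᵥ e ω) ^ 2 / risk ν (v k)) P :=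
    fun k => (hmom k).1.integrable_sq.div_const _
  have hnn : ∀ ω, 0 ≤ ∑ k, (v k ⬝ᵥ e ω) ^ 2 / risk ν (v k) := fun ω =>
    Finset.sum_nonneg fun k _ => div_nonneg (sq_nonneg _) (hν.risk_nonneg _)
  have hsqrt : ∀ ω, √(∑ k, (v k ⬝ᵥ e ω) ^ 2 / risk ν (v k)) ^ 2 =
      ∑ k, (v k ⬝ᵥ e ω) ^ 2 / risk ν (v k) := fun ω => Real.sq_sqrt (hnn ω)
  have hn0 : (0 : ℝ) < n := by positivity
  refine ⟨fun ω => √(∑ k, (v k ⬝ᵥ e ω) ^ 2 / risk ν (v k)), fun ω => Real.sqrt_nonneg _, ?_, ?_,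
    ?_⟩
  · rw [memLp_two_iff_integrable_sq]
    · simp only [hsqrt]
      exact integrable_finsetSum _ fun k _ => hint k
    · exact Real.continuous_sqrt.comp_aestronglyMeasurable
        (integrable_finsetSum _ fun k _ => hint k).aestronglyMeasurable
  · simp only [hsqrt]
    rw [integral_finsetSum _ fun k _ => hint k]
    calc ∑ k, ∫ ω, (v k ⬝ᵥ e ω) ^ 2 / risk ν (v k) ∂P ≤ ∑ k : Fin d, 1 / (n : ℝ) := by
          refine Finset.sum_le_sum fun k _ => ?_
          rw [integral_div, (hmom k).2]
          rcases (hν.risk_nonneg (v k)).eq_or_lt with h | h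
          · rw [← h]; simp
          · rw [div_right_comm, div_self h.ne']
      _ = d / n := by simp [div_eq_mul_inv]
  · have hz : ∀ k, risk ν (v k) = 0 → ∀ᵐ ω ∂P, v k ⬝ᵥ e ω = 0 := by
      intro k hk
      have h := (hmom k).2
      rw [hk, zero_div, integral_eq_zero_iff_of_nonneg (fun _ => sq_nonneg _)
        (hmom k).1.integrable_sq] at h
      filter_upwards [h] with ω hω
      exact pow_eq_zero_iff two_ne_zero |>.1 hω
    have hz' : ∀ᵐ ω ∂P, ∀ k, risk ν (v k) = 0 → v k ⬝ᵥ e ω = 0 := by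
      rw [ae_all_iff]
      intro k
      by_cases hk : risk ν (v k) = 0
      · filter_upwards [hz k hk] with ω hω _ using hω
      · exact ae_of_all _ fun ω h => absurd h hk
    filter_upwards [hz'] with ω hω u
    rw [← Real.sqrt_mul (hν.risk_nonneg u)]
    apply Real.abs_le_sqrt
    change (u ⬝ᵥ e ω) ^ 2 ≤ _
    rw [hv u (e ω), hvS u]
    have hterm : ∀ k, (u ⬝ᵥ v k) * (v k ⬝ᵥ e ω) =
        (√(risk ν (v k)) * (u ⬝ᵥ v k)) * ((v k ⬝ᵥ e ω) / √(risk ν (v k))) := by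
      intro k
      rcases (hν.risk_nonneg (v k)).eq_or_lt with h | h
      · rw [hω k h.symm]; simp
      · have := (Real.sqrt_pos.2 h).ne'
        field_simp
    simp only [hterm]
    refine (Finset.sum_mul_sq_le_sq_mul_sq _ _ _).trans_eq ?_
    simp only [mul_pow, div_pow, Real.sq_sqrt (hν.risk_nonneg _)]

theorem empCov_sub_eq (x : ℕ → Fin d → ℝ) (m : Fin d → ℝ) (S : Matrix (Fin d) (Fin d) ℝ)
    (i j : Fin d) {n : ℕ} (hn : 1 ≤ n) :
    empCov x n i j - S i j =
      (1 / (n : ℝ)) * ∑ s ∈ Finset.range n, ((x s i - m i) * (x s j - m j) - S i j) -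
        (empMean x n i - m i) * (empMean x n j - m j) := by
  have hn0 : (n : ℝ) ≠ 0 := by positivity
  have hs : ∀ k, ∑ s ∈ Finset.range n, x s k = n * empMean x n k := by
    intro k
    simp only [empMean]
    field_simp
  have h1 : ∀ a b : ℝ, ∑ s ∈ Finset.range n, (x s i - a) * (x s j - b) =
      ∑ s ∈ Finset.range n, x s i * x s j - b * (n * empMean x n i) - a * (n * empMean x n j)
        + n * (a * b) := by
    intro a b
    rw [← hs, ← hs, Finset.mul_sum, Finset.mul_sum, ← Finset.sum_sub_distrib,
      ← Finset.sum_sub_distrib, ← nsmul_eq_mul, ← Finset.card_range n, ← Finset.sum_const,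
      Finset.card_range, ← Finset.sum_add_distrib]
    exact Finset.sum_congr rfl fun s _ => by ring
  simp only [empCov, Matrix.of_apply]
  rw [Finset.sum_sub_distrib, h1, h1]
  simp only [Finset.sum_const, Finset.card_range, nsmul_eq_mul]
  field_simp
  ring

theorem integral_abs_le_of_sq_le {f : Ω → ℝ} (hf : MemLp f 2 P) {A r : ℝ} (hr : 0 < r)
    (h : ∫ ω, f ω ^ 2 ∂P ≤ A / r ^ 2) : ∫ ω, |f ω| ∂P ≤ (A + 1) / (2 * r) := by
  calc ∫ ω, |f ω| ∂P ≤ ∫ ω, (f ω ^ 2 * (r / 2) + 1 / (2 * r)) ∂P := by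
        refine integral_mono (hf.integrable one_le_two).abs
          ((hf.integrable_sq.mul_const _).add (integrable_const _)) fun ω => ?_
        change |f ω| ≤ f ω ^ 2 * (r / 2) + 1 / (2 * r)
        have h1 : f ω ^ 2 * (r / 2) + 1 / (2 * r) - |f ω| = (r * |f ω| - 1) ^ 2 / (2 * r) := by
          rw [← sq_abs]; field_simp; ring
        have h2 : 0 ≤ (r * |f ω| - 1) ^ 2 / (2 * r) := by positivity
        linarith
    _ = (∫ ω, f ω ^ 2 ∂P) * (r / 2) + 1 / (2 * r) := by
        rw [integral_add (hf.integrable_sq.mul_const _) (integrable_const _), integral_mul_const]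
        simp
    _ ≤ A / r ^ 2 * (r / 2) + 1 / (2 * r) := by gcongr
    _ = (A + 1) / (2 * r) := by field_simp

/-- The estimation error of the covariance matrix. -/
noncomputable def covError (ν : Measure (Fin d → ℝ)) (x : ℕ → Fin d → ℝ) (n : ℕ) : ℝ :=
  ∑ i, ∑ j, |empCov x n i j - covMat ν i j|

theorem IsEnvironment.integral_covError_le (hE : IsEnvironment P ν θ) (hν : IsRewardLaw ν)
    {n : ℕ} (hn : 1 ≤ n) :
    Integrable (fun ω => covError ν (fun s => θ s ω) n) P ∧
      ∫ ω, covError ν (fun s => θ s ω) n ∂P ≤ 50 * (d : ℝ) ^ 2 / √n := by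
  have hp := hν.prob
  have hn1 : (1 : ℝ) ≤ n := by exact_mod_cast hn
  have hr : 0 < √(n : ℝ) := by positivity
  have hrn : √(n : ℝ) ^ 2 = n := Real.sq_sqrt (by positivity)
  have hij : ∀ i j, Integrable (fun ω => |empCov (fun s => θ s ω) n i j - covMat ν i j|) P ∧
      ∫ ω, |empCov (fun s => θ s ω) n i j - covMat ν i j| ∂P ≤ 50 / √n := by
    intro i j
    have hA := hE.average_sq
      (g := fun x => (x i - mean ν i) * (x j - mean ν j) - covMat ν i j) (by fun_prop)
      ((hν.memLp_mul i j).sub (memLp_const _))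
      (by rw [integral_sub (hν.integrable_mul i j) (integrable_const _), integral_mul_eq_covMat]
          simp) hn
    have hB : ∀ k, MemLp (fun ω => empMean (fun s => θ s ω) n k - mean ν k) 2 P ∧
        ∫ ω, (empMean (fun s => θ s ω) n k - mean ν k) ^ 2 ∂P ≤ 1 / n := by
      intro k
      have h := hE.dotProduct_empMean hν (Pi.single k 1) hn
      simp only [single_dotProduct, Pi.sub_apply, one_mul] at h
      refine ⟨h.1, h.2.le.trans ?_⟩
      gcongr
      simpa [risk] using hν.var_le_one k
    have hA' := integral_abs_le_of_sq_le (A := 96) hA.1 hr (by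
      rw [hA.2, hrn, div_eq_mul_one_div 96, mul_comm]
      gcongr
      exact hν.integral_sq_mul_sub_le i j)
    simp only [empCov_sub_eq _ (mean ν) (covMat ν) i j hn]
    have hBint := (hB i).1.integrable_mul (hB j).1
    refine ⟨((hA.1.integrable one_le_two).sub hBint).abs, ?_⟩
    have hb1 := (hB i).1.integrable_sq.div_const 2
    have hb2 := (hB j).1.integrable_sq.div_const 2
    have hb : Integrable (fun ω => (empMean (fun s => θ s ω) n i - mean ν i) ^ 2 / 2 +
        (empMean (fun s => θ s ω) n j - mean ν j) ^ 2 / 2) P := hb1.add hb2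
    calc _ ≤ ∫ ω, (|(1 / (n : ℝ)) * ∑ s ∈ Finset.range n,
              ((θ s ω i - mean ν i) * (θ s ω j - mean ν j) - covMat ν i j)| +
            ((empMean (fun s => θ s ω) n i - mean ν i) ^ 2 / 2 +
              (empMean (fun s => θ s ω) n j - mean ν j) ^ 2 / 2)) ∂P := by
          refine integral_mono ((hA.1.integrable one_le_two).sub hBint).abs
            ((hA.1.integrable one_le_two).abs.add hb) fun ω => ?_
          refine (abs_sub _ _).trans (add_le_add_right ?_ _)
          rw [abs_le]
          constructor <;> nlinarith [sq_nonneg ((empMean (fun s => θ s ω) n i - mean ν i) -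
            (empMean (fun s => θ s ω) n j - mean ν j)),
            sq_nonneg ((empMean (fun s => θ s ω) n i - mean ν i) +
            (empMean (fun s => θ s ω) n j - mean ν j))]
      _ ≤ (96 + 1) / (2 * √n) + 1 / n := by
          rw [integral_add (hA.1.integrable one_le_two).abs hb, integral_add hb1 hb2,
            integral_div, integral_div]
          linarith [(hB i).2, (hB j).2]
      _ ≤ 50 / √n := by
          have : 1 / (n : ℝ) ≤ 1 / √n := by
            gcongr
            rw [Real.sqrt_le_left (by positivity)]
            nlinarith
          have e1 : (96 + 1) / (2 * √(n : ℝ)) = 97 / 2 * (1 / √n) := by field_simp; norm_num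
          have e2 : 50 / √(n : ℝ) = 50 * (1 / √n) := by field_simp
          have : 0 < 1 / √(n : ℝ) := by positivity
          rw [e1, e2]
          linarith
  refine ⟨integrable_finsetSum _ fun i _ => integrable_finsetSum _ fun j _ => (hij i j).1, ?_⟩
  unfold covError
  rw [integral_finsetSum _ fun i _ => integrable_finsetSum _ fun j _ => (hij i j).1]
  calc _ ≤ ∑ i : Fin d, ∑ j : Fin d, 50 / √(n : ℝ) := by
        refine Finset.sum_le_sum fun i _ => ?_
        rw [integral_finsetSum _ fun j _ => (hij i j).1]
        exact Finset.sum_le_sum fun j _ => (hij i j).2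
    _ = 50 * (d : ℝ) ^ 2 / √n := by
        simp only [Finset.sum_const, Finset.card_univ, Fintype.card_fin, nsmul_eq_mul]
        ring

end CMCB

namespace CMCB

variable {d : ℕ} {ν : Measure (Fin d → ℝ)}

/-! ### Regret of a single round, sample by sample -/

theorem abs_quadForm_le {w : Fin d → ℝ} (hw : w ∈ stdSimplex ℝ (Fin d))
    (A : Matrix (Fin d) (Fin d) ℝ) : |w ⬝ᵥ (A *ᵥ w)| ≤ ∑ i, ∑ j, |A i j| := by
  have h01 : ∀ i, 0 ≤ w i ∧ w i ≤ 1 := fun i =>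
    ⟨hw.1 i, hw.2 ▸ Finset.single_le_sum (fun j _ => hw.1 j) (Finset.mem_univ i)⟩
  simp only [dotProduct, Matrix.mulVec, Finset.mul_sum]
  refine (Finset.abs_sum_le_sum_abs _ _).trans (Finset.sum_le_sum fun i _ => ?_)
  refine (Finset.abs_sum_le_sum_abs _ _).trans (Finset.sum_le_sum fun j _ => ?_)
  rw [abs_mul, abs_mul, abs_of_nonneg (h01 i).1, abs_of_nonneg (h01 j).1]
  have h1 : |A i j| * w j ≤ |A i j| := mul_le_of_le_one_right (abs_nonneg _) (h01 j).2
  exact (mul_le_of_le_one_left (mul_nonneg (abs_nonneg _) (h01 j).1) (h01 i).2).trans h1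

theorem dotProduct_sub_le_meanGap {w w' : Fin d → ℝ} (hw : w ∈ stdSimplex ℝ (Fin d))
    (hw' : w' ∈ stdSimplex ℝ (Fin d)) : w ⬝ᵥ mean ν - w' ⬝ᵥ mean ν ≤ meanGap ν := by
  have hu : w ⬝ᵥ mean ν ≤ ⨆ i, mean ν i := by
    calc w ⬝ᵥ mean ν ≤ ∑ i, w i * ⨆ i, mean ν i := by
          refine Finset.sum_le_sum fun i _ => mul_le_mul_of_nonneg_left ?_ (hw.1 i)
          exact le_ciSup (Set.finite_range _).bddAbove i
      _ = _ := by rw [← Finset.sum_mul, hw.2, one_mul]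
  have hl : ⨅ i, mean ν i ≤ w' ⬝ᵥ mean ν := by
    calc ⨅ i, mean ν i = ∑ i, w' i * ⨅ i, mean ν i := by rw [← Finset.sum_mul, hw'.2, one_mul]
      _ ≤ w' ⬝ᵥ mean ν := by
          refine Finset.sum_le_sum fun i _ => mul_le_mul_of_nonneg_left ?_ (hw'.1 i)
          exact ciInf_le (Set.finite_range _).bddBelow i
  unfold meanGap
  linarith

theorem meanGap_nonneg {w : Fin d → ℝ} (hw : w ∈ stdSimplex ℝ (Fin d)) : 0 ≤ meanGap ν := by
  simpa using dotProduct_sub_le_meanGap (ν := ν) hw hw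

theorem covError_nonneg (x : ℕ → Fin d → ℝ) (n : ℕ) : 0 ≤ covError ν x n :=
  Finset.sum_nonneg fun _ _ => Finset.sum_nonneg fun _ _ => abs_nonneg _

theorem abs_empCov_quadForm_sub_risk_le {w : Fin d → ℝ} (hw : w ∈ stdSimplex ℝ (Fin d))
    (x : ℕ → Fin d → ℝ) (n : ℕ) : |w ⬝ᵥ (empCov x n *ᵥ w) - risk ν w| ≤ covError ν x n := by
  have h := abs_quadForm_le hw (empCov x n - covMat ν)
  rwa [Matrix.sub_mulVec, dotProduct_sub] at h

theorem regret_le_of_isArgmax {ρ : ℝ} (hρ : 0 < ρ) {x : ℕ → Fin d → ℝ} {n : ℕ}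
    {wstar w : Fin d → ℝ} (hstar : wstar ∈ stdSimplex ℝ (Fin d))
    (hw : IsArgmax (empMean x n) (empCov x n) ρ w) {N : ℝ}
    (hN : ∀ u : Fin d → ℝ, |u ⬝ᵥ (empMean x n - mean ν)| ≤ √(risk ν u) * N) :
    meanCov (mean ν) (covMat ν) ρ wstar - meanCov (mean ν) (covMat ν) ρ w ≤
      (√(risk ν wstar) + √(risk ν w)) * N + 2 * ρ * covError ν x n := by
  have hopt := hw.2 hstar
  have h1 := abs_le.1 (abs_empCov_quadForm_sub_risk_le (ν := ν) hstar x n)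
  have h2 := abs_le.1 (abs_empCov_quadForm_sub_risk_le (ν := ν) hw.1 x n)
  have h3 := abs_le.1 (hN wstar)
  have h4 := abs_le.1 (hN w)
  rw [dotProduct_sub] at h3 h4
  simp only [Set.mem_ofPred_eq, meanCov] at hopt ⊢
  change wstar ⬝ᵥ mean ν - ρ * risk ν wstar - (w ⬝ᵥ mean ν - ρ * risk ν w) ≤ _
  have h1' := mul_le_mul_of_nonneg_left h1.2 hρ.le
  have h2' := mul_le_mul_of_nonneg_left h2.1 hρ.le
  linarith

theorem sqrt_risk_le_of_isArgmax (hν : IsRewardLaw ν) {ρ : ℝ} (hρ : 0 < ρ)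
    {x : ℕ → Fin d → ℝ} {n : ℕ} {wstar w : Fin d → ℝ} (hstar : wstar ∈ stdSimplex ℝ (Fin d))
    (hw : IsArgmax (empMean x n) (empCov x n) ρ w) {N : ℝ} (hN0 : 0 ≤ N)
    (hN : ∀ u : Fin d → ℝ, |u ⬝ᵥ (empMean x n - mean ν)| ≤ √(risk ν u) * N) :
    √(risk ν w) ≤
      √(risk ν wstar) + √(meanGap ν / ρ) + √(2 * covError ν x n) + N / ρ := by
  have hopt := hw.2 hstar
  have h1 := abs_le.1 (abs_empCov_quadForm_sub_risk_le (ν := ν) hstar x n)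
  have h2 := abs_le.1 (abs_empCov_quadForm_sub_risk_le (ν := ν) hw.1 x n)
  have h3 := abs_le.1 (hN wstar)
  have h4 := abs_le.1 (hN w)
  have hgap := dotProduct_sub_le_meanGap (ν := ν) hw.1 hstar
  have hg0 := meanGap_nonneg (ν := ν) hstar
  have hd0 := covError_nonneg (ν := ν) x n
  rw [dotProduct_sub] at h3 h4
  simp only [Set.mem_ofPred_eq, meanCov] at hopt
  have h1' := mul_le_mul_of_nonneg_left h1.2 hρ.le
  have h2' := mul_le_mul_of_nonneg_left h2.1 hρ.le
  set a := √(risk ν wstar)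
  set b := √(risk ν w)
  have ha : a ^ 2 = risk ν wstar := Real.sq_sqrt (hν.risk_nonneg _)
  have hb : b ^ 2 = risk ν w := Real.sq_sqrt (hν.risk_nonneg _)
  have ha0 : 0 ≤ a := Real.sqrt_nonneg _
  have hb0 : 0 ≤ b := Real.sqrt_nonneg _
  have hNρ : 0 ≤ N / ρ := by positivity
  have hmain : b ^ 2 ≤ a ^ 2 + 2 * covError ν x n + meanGap ν / ρ + (a + b) * (N / ρ) := by
    have : ρ * b ^ 2 ≤
        ρ * (a ^ 2 + 2 * covError ν x n + meanGap ν / ρ + (a + b) * (N / ρ)) := by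
      have e : ρ * (a ^ 2 + 2 * covError ν x n + meanGap ν / ρ + (a + b) * (N / ρ)) =
          ρ * a ^ 2 + 2 * ρ * covError ν x n + meanGap ν + (a + b) * N := by
        field_simp
      rw [e, ha, hb]
      linarith
    exact le_of_mul_le_mul_left this hρ
  set g := √(meanGap ν / ρ)
  set c := √(2 * covError ν x n)
  have hg : g ^ 2 = meanGap ν / ρ := Real.sq_sqrt (by positivity)
  have hc : c ^ 2 = 2 * covError ν x n := Real.sq_sqrt (by positivity)
  have hg0' : 0 ≤ g := Real.sqrt_nonneg _
  have hc0' : 0 ≤ c := Real.sqrt_nonneg _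
  rw [← hg, ← hc] at hmain
  by_contra! hlt
  have h5 : (g + c) < b - a - N / ρ := by linarith
  have h6 : (g + c) ^ 2 < (b - a - N / ρ) ^ 2 := by gcongr
  nlinarith [mul_nonneg hg0' hc0', mul_nonneg (by linarith : 0 ≤ b - a - N / ρ)
    (by linarith : 0 ≤ 2 * a + N / ρ)]

/-! ### Expected regret of a single round -/

theorem regret_le_maxRegret {ρ : ℝ} {wstar w : Fin d → ℝ} (hw : w ∈ stdSimplex ℝ (Fin d)) :
    meanCov (mean ν) (covMat ν) ρ wstar - meanCov (mean ν) (covMat ν) ρ w ≤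
      maxRegret ν ρ wstar := by
  refine le_csSup (IsCompact.bddAbove_image (isCompact_stdSimplex ℝ (Fin d)) ?_) ⟨w, hw, rfl⟩
  simp only [meanCov, dotProduct, Matrix.mulVec]
  fun_prop

theorem maxRegret_le (hν : IsRewardLaw ν) (hd : 1 ≤ d) {ρ : ℝ} (hρ : 0 < ρ)
    {wstar : Fin d → ℝ} (hstar : wstar ∈ stdSimplex ℝ (Fin d)) :
    maxRegret ν ρ wstar ≤ meanGap ν + ρ := by
  have : NeZero d := ⟨by omega⟩
  refine csSup_le (Set.Nonempty.image _ ⟨wstar, hstar⟩) ?_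
  rintro _ ⟨w, hw, rfl⟩
  have h1 := dotProduct_sub_le_meanGap (ν := ν) hstar hw
  have h2 := (hν.risk_le_varMax hw).trans hν.varMax_le_one
  have h3 := hν.risk_nonneg wstar
  change wstar ⬝ᵥ mean ν - ρ * risk ν wstar - (w ⬝ᵥ mean ν - ρ * risk ν w) ≤ _
  nlinarith [mul_nonneg hρ.le h3]

variable {Ω : Type*} [MeasurableSpace Ω] {P : Measure Ω} [IsProbabilityMeasure P]
  {θ w : ℕ → Ω → Fin d → ℝ}

theorem IsMCEmpirical.mem_stdSimplex {ρ : ℝ} (hM : IsMCEmpirical ρ θ w) (hd : 1 ≤ d) (t : ℕ)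
    (ω : Ω) : w t ω ∈ stdSimplex ℝ (Fin d) := by
  rcases Nat.eq_zero_or_pos t with rfl | ht
  · rw [hM.first]
    have : (d : ℝ) ≠ 0 := by positivity
    refine ⟨fun _ => by positivity, ?_⟩
    simp [this]
  · exact (hM.argmax t ht ω).1

theorem integral_regret_le_maxRegret {ρ : ℝ} {wstar : Fin d → ℝ} {v : Ω → Fin d → ℝ}
    (hstar : IsArgmax (mean ν) (covMat ν) ρ wstar) (hv : ∀ ω, v ω ∈ stdSimplex ℝ (Fin d)) :
    ∫ ω, (meanCov (mean ν) (covMat ν) ρ wstar - meanCov (mean ν) (covMat ν) ρ (v ω)) ∂P ≤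
      maxRegret ν ρ wstar := by
  refine (integral_mono_of_nonneg (ae_of_all _ fun ω => sub_nonneg.2 (hstar.2 (hv ω)))
    (integrable_const (maxRegret ν ρ wstar))
    (ae_of_all _ fun ω => regret_le_maxRegret (hv ω))).trans ?_
  simp

theorem integral_regret_le (hν : IsRewardLaw ν) (hd : 1 ≤ d) {ρ : ℝ} (hρ : 0 < ρ)
    {wstar : Fin d → ℝ} (hstar : IsArgmax (mean ν) (covMat ν) ρ wstar)
    (hE : IsEnvironment P ν θ) (hM : IsMCEmpirical ρ θ w) {n : ℕ} (hn : 1 ≤ n) :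
    ∫ ω, (meanCov (mean ν) (covMat ν) ρ wstar - meanCov (mean ν) (covMat ν) ρ (w n ω)) ∂P ≤
        51 * (d : ℝ) ^ 2 * ((2 * √(risk ν wstar) + √(meanGap ν / ρ) + 2 * ρ) * (1 / √n) +
          1 / (√n * √√n) + 1 / ρ * (1 / n)) ∧
      ∫ ω, (meanCov (mean ν) (covMat ν) ρ wstar - meanCov (mean ν) (covMat ν) ρ (w n ω)) ∂P ≤
        51 * (d : ℝ) ^ 2 * ((2 * √(varMax ν) + 2 * ρ) * (1 / √n)) := by
  obtain ⟨N, hN0, hN2, hNsq, hN⟩ := hE.exists_mean_error hν hn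
  obtain ⟨hδi, hδ⟩ := hE.integral_covError_le hν hn
  have hd1 : (1 : ℝ) ≤ d := by exact_mod_cast hd
  have hn1 : (1 : ℝ) ≤ n := by exact_mod_cast hn
  have hs : 0 < √(n : ℝ) := by positivity
  have hsn : √(n : ℝ) ^ 2 = n := Real.sq_sqrt (by positivity)
  have hr : 0 < √√(n : ℝ) := by positivity
  have hrs : √√(n : ℝ) ^ 2 = √n := Real.sq_sqrt (by positivity)
  have hN1 : ∫ ω, N ω ∂P ≤ 51 * (d : ℝ) ^ 2 * (1 / √n) := by
    have h := integral_abs_le_of_sq_le hN2 hs (A := d) (by rwa [hsn])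
    simp only [abs_of_nonneg (hN0 _)] at h
    refine h.trans ?_
    rw [show ((d : ℝ) + 1) / (2 * √n) = (d + 1) / 2 * (1 / √n) by field_simp]
    gcongr
    nlinarith
  have hδ' : ∫ ω, covError ν (fun s => θ s ω) n ∂P ≤ 51 * (d : ℝ) ^ 2 * (1 / √n) := by
    refine hδ.trans ?_
    rw [div_eq_mul_one_div]
    gcongr
    norm_num
  have hNi : Integrable N P := hN2.integrable one_le_two
  have hN2i : Integrable (fun ω => N ω ^ 2) P := hN2.integrable_sq
  have hnn : 0 ≤ᵐ[P] fun ω =>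
      meanCov (mean ν) (covMat ν) ρ wstar - meanCov (mean ν) (covMat ν) ρ (w n ω) :=
    ae_of_all _ fun ω => sub_nonneg.2 (hstar.2 (hM.argmax n hn ω).1)
  set r := √√(n : ℝ)
  set δ : Ω → ℝ := fun ω => covError ν (fun s => θ s ω) n with hδdef
  set a := √(risk ν wstar) with ha
  set g := √(meanGap ν / ρ) with hg
  have hδr : ∫ ω, δ ω ∂P ≤ 50 * (d : ℝ) ^ 2 * (1 / √n) := by
    rw [← div_eq_mul_one_div]; exact hδ
  constructor
  · have hi1 : Integrable (fun ω => (2 * a + g) * N ω) P := hNi.const_mul _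
    have hi2 : Integrable (fun ω => (r / 2 + 1 / ρ) * N ω ^ 2) P := hN2i.const_mul _
    have hi3 : Integrable (fun ω => (1 / r + 2 * ρ) * δ ω) P := hδi.const_mul _
    have hi12 : Integrable (fun ω => (2 * a + g) * N ω + (r / 2 + 1 / ρ) * N ω ^ 2) P :=
      hi1.add hi2
    refine (integral_mono_of_nonneg hnn (hi12.add hi3) ?_).trans ?_
    · filter_upwards [hN] with ω hω
      have h1 := regret_le_of_isArgmax hρ hstar.1 (hM.argmax n hn ω) hω
      have h2 := sqrt_risk_le_of_isArgmax hν hρ hstar.1 (hM.argmax n hn ω) (hN0 ω) hω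
      have h3 := mul_le_mul_of_nonneg_right h2 (hN0 ω)
      rw [← ha] at h1 h3
      rw [← hg] at h3
      change _ ≤ (2 * a + g) * N ω + (r / 2 + 1 / ρ) * N ω ^ 2 + (1 / r + 2 * ρ) * δ ω
      have hc : √(2 * δ ω) ^ 2 = 2 * δ ω :=
        Real.sq_sqrt (mul_nonneg zero_le_two (covError_nonneg _ _))
      have h4 : √(2 * δ ω) * N ω ≤ r / 2 * N ω ^ 2 + 1 / r * δ ω := by
        have e : r / 2 * N ω ^ 2 + 1 / r * δ ω - √(2 * δ ω) * N ω =
            (r * N ω - √(2 * δ ω)) ^ 2 / (2 * r) := by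
          have : δ ω = √(2 * δ ω) ^ 2 / 2 := by rw [hc]; ring
          generalize √(2 * δ ω) = c at *
          rw [this]
          field_simp
          ring
        have : 0 ≤ (r * N ω - √(2 * δ ω)) ^ 2 / (2 * r) := by positivity
        linarith
      have e1 : N ω / ρ * N ω = 1 / ρ * N ω ^ 2 := by ring
      change _ ≤ (a + g + √(2 * δ ω) + N ω / ρ) * N ω at h3
      change _ ≤ (a + √(risk ν (w n ω))) * N ω + 2 * ρ * δ ω at h1
      linarith
    · simp only [Pi.add_apply]
      rw [integral_add hi12 hi3, integral_add hi1 hi2, integral_const_mul, integral_const_mul,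
        integral_const_mul]
      have hrn : r * (1 / (n : ℝ)) = 1 / (√n * r) := by
        rw [mul_one_div, div_eq_div_iff (by positivity) (by positivity)]
        linear_combination √(n : ℝ) * hrs + hsn
      have b1 := mul_le_mul_of_nonneg_left hN1 (by positivity : 0 ≤ 2 * a + g)
      have b2 := mul_le_mul_of_nonneg_left hNsq (by positivity : 0 ≤ r / 2 + 1 / ρ)
      have b3 := mul_le_mul_of_nonneg_left hδr (by positivity : 0 ≤ 1 / r)
      have b4 := mul_le_mul_of_nonneg_left hδ' (by positivity : 0 ≤ 2 * ρ)
      have e2 : (r / 2 + 1 / ρ) * ((d : ℝ) / n) =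
          d / 2 * (1 / (√n * r)) + d * (1 / ρ * (1 / n)) := by
        rw [← hrn]; ring
      have e3 : 1 / r * (50 * (d : ℝ) ^ 2 * (1 / √n)) = 50 * (d : ℝ) ^ 2 * (1 / (√n * r)) := by
        field_simp
      rw [e2] at b2
      rw [e3] at b3
      have hp1 : 0 ≤ 1 / (√(n : ℝ) * r) := by positivity
      have hp2 : 0 ≤ 1 / ρ * (1 / (n : ℝ)) := by positivity
      have hdd : (d : ℝ) ≤ d ^ 2 := by nlinarith
      have c1 := mul_le_mul_of_nonneg_right hdd hp1
      have c2 := mul_le_mul_of_nonneg_right hdd hp2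
      have c3 : 0 ≤ (d : ℝ) ^ 2 * (1 / (√(n : ℝ) * r)) := by positivity
      have c4 : 0 ≤ (d : ℝ) ^ 2 * (1 / ρ * (1 / (n : ℝ))) := by positivity
      linarith
  · have hi1 : Integrable (fun ω => (2 * √(varMax ν)) * N ω) P := hNi.const_mul _
    have hi3 : Integrable (fun ω => (2 * ρ) * δ ω) P := hδi.const_mul _
    refine (integral_mono_of_nonneg hnn (hi1.add hi3) ?_).trans ?_
    · filter_upwards [hN] with ω hω
      have h1 := regret_le_of_isArgmax hρ hstar.1 (hM.argmax n hn ω) hω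
      have h2 := Real.sqrt_le_sqrt (hν.risk_le_varMax hstar.1)
      have h3 := Real.sqrt_le_sqrt (hν.risk_le_varMax (hM.argmax n hn ω).1)
      have h4 := mul_le_mul_of_nonneg_right (add_le_add h2 h3) (hN0 ω)
      change _ ≤ 2 * √(varMax ν) * N ω + 2 * ρ * δ ω
      change _ ≤ _ + 2 * ρ * δ ω at h1
      linarith
    · simp only [Pi.add_apply]
      rw [integral_add hi1 hi3, integral_const_mul, integral_const_mul]
      have b1 := mul_le_mul_of_nonneg_left hN1 (by positivity : 0 ≤ 2 * √(varMax ν))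
      have b4 := mul_le_mul_of_nonneg_left hδ' (by positivity : 0 ≤ 2 * ρ)
      linarith

/-! ### Cumulative regret -/

theorem expectedRegret_le_mul_maxRegret (hd : 1 ≤ d) {ρ : ℝ} {wstar : Fin d → ℝ}
    (hstar : IsArgmax (mean ν) (covMat ν) ρ wstar) (hM : IsMCEmpirical ρ θ w) (T : ℕ) :
    expectedRegret P ν ρ wstar w T ≤ T * maxRegret ν ρ wstar := by
  refine (Finset.sum_le_sum fun t _ =>
    integral_regret_le_maxRegret hstar (hM.mem_stdSimplex hd t)).trans ?_
  simp

theorem maxRegret_nonneg {ρ : ℝ} {wstar : Fin d → ℝ}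
    (hstar : IsArgmax (mean ν) (covMat ν) ρ wstar) : 0 ≤ maxRegret ν ρ wstar := by
  simpa using regret_le_maxRegret (ν := ν) (ρ := ρ) (wstar := wstar) hstar.1

theorem expectedRegret_le (hν : IsRewardLaw ν) (hd : 1 ≤ d) {ρ : ℝ} (hρ : 0 < ρ)
    {wstar : Fin d → ℝ} (hstar : IsArgmax (mean ν) (covMat ν) ρ wstar)
    (hE : IsEnvironment P ν θ) (hM : IsMCEmpirical ρ θ w) {T : ℕ} (hT : 1 ≤ T) :
    expectedRegret P ν ρ wstar w T ≤
        51 * (d : ℝ) ^ 2 * ((2 * √(risk ν wstar) + √(meanGap ν / ρ) + 2 * ρ) * (2 * √T) +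
          4 * √√T + 1 / ρ * (1 + Real.log T)) + maxRegret ν ρ wstar ∧
      expectedRegret P ν ρ wstar w T ≤
        51 * (d : ℝ) ^ 2 * ((2 * √(varMax ν) + 2 * ρ) * (2 * √T)) + maxRegret ν ρ wstar := by
  obtain ⟨n, rfl⟩ : ∃ n, T = n + 1 := ⟨T - 1, by omega⟩
  have hround := fun t : ℕ => integral_regret_le hν hd hρ hstar hE hM (Nat.le_add_left 1 t)
  have hfirst := integral_regret_le_maxRegret (P := P) hstar (hM.mem_stdSimplex hd 0)
  push_cast at hround
  have hnT : (n : ℝ) ≤ ((n + 1 : ℕ) : ℝ) := by push_cast; linarith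
  have s1 : ∑ t ∈ Finset.range n, 1 / √((t : ℝ) + 1) ≤ 2 * √((n + 1 : ℕ) : ℝ) :=
    (sum_inv_sqrt_le n).trans (by gcongr)
  have s2 : ∑ t ∈ Finset.range n, 1 / (√((t : ℝ) + 1) * √√((t : ℝ) + 1)) ≤
      4 * √√((n + 1 : ℕ) : ℝ) :=
    (sum_inv_sqrt_mul_sqrt_sqrt_le n).trans (by gcongr)
  have s3 : ∑ t ∈ Finset.range n, 1 / ((t : ℝ) + 1) ≤ 1 + Real.log ((n + 1 : ℕ) : ℝ) := by
    refine (sum_inv_le n).trans (add_le_add_right ?_ _)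
    rcases Nat.eq_zero_or_pos n with rfl | h
    · simp
    · exact Real.log_le_log (by positivity) hnT
  unfold expectedRegret
  rw [Finset.sum_range_succ']
  constructor
  · refine add_le_add ((Finset.sum_le_sum fun t _ => (hround t).1).trans ?_) hfirst
    rw [← Finset.mul_sum, Finset.sum_add_distrib, Finset.sum_add_distrib, ← Finset.mul_sum,
      ← Finset.mul_sum]
    gcongr
  · refine add_le_add ((Finset.sum_le_sum fun t _ => (hround t).2).trans ?_) hfirst
    rw [← Finset.mul_sum, ← Finset.mul_sum]
    gcongr

theorem expectedRegret_le_add_maxRegret (hν : IsRewardLaw ν) (hd : 1 ≤ d) {ρ : ℝ} (hρ : 0 < ρ)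
    {wstar : Fin d → ℝ} (hstar : IsArgmax (mean ν) (covMat ν) ρ wstar)
    (hE : IsEnvironment P ν θ) (hM : IsMCEmpirical ρ θ w) {T : ℕ} (hT : 1 ≤ T) :
    expectedRegret P ν ρ wstar w T ≤
      4 * ((min (√(risk ν wstar) + ρ ^ (-(1 / 2) : ℝ) * √(meanGap ν)
              + ((T : ℝ) ^ (-(1 / 4) : ℝ) * (ρ ^ (-(1 / 2) : ℝ) + 1)
                + Real.log T / (ρ * √T)))
            (√(varMax ν)) + ρ) * Real.log T * √T)
        + (Real.exp (51 * (d : ℝ) ^ 2) + 1) * maxRegret ν ρ wstar := by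
  have hT1 : (1 : ℝ) ≤ T := by exact_mod_cast hT
  have hL0 : 0 ≤ Real.log T := Real.log_nonneg hT1
  have hΔ := maxRegret_nonneg (ν := ν) hstar
  have hs : 0 < √(T : ℝ) := by positivity
  have hρ' : 0 < ρ ^ (-(1 / 2) : ℝ) := by positivity
  have hT' : 0 < (T : ℝ) ^ (-(1 / 4) : ℝ) := by positivity
  by_cases hL : 51 * (d : ℝ) ^ 2 ≤ Real.log T
  · obtain ⟨h1, h2⟩ := expectedRegret_le hν hd hρ hstar hE hM hT
    have hD1 : 1 ≤ 51 * (d : ℝ) ^ 2 := by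
      have : (1 : ℝ) ≤ d := by exact_mod_cast hd
      nlinarith
    have hK : maxRegret ν ρ wstar ≤ (Real.exp (51 * (d : ℝ) ^ 2) + 1) * maxRegret ν ρ wstar := by
      nlinarith [mul_nonneg (Real.exp_pos (51 * (d : ℝ) ^ 2)).le hΔ]
    have hgap : √(meanGap ν / ρ) = ρ ^ (-(1 / 2) : ℝ) * √(meanGap ν) := by
      rw [Real.sqrt_div' _ hρ.le, Real.rpow_neg hρ.le, ← Real.sqrt_eq_rpow]
      ring
    have hquart : √√(T : ℝ) = (T : ℝ) ^ (-(1 / 4) : ℝ) * √T := by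
      rw [Real.sqrt_eq_rpow, Real.sqrt_eq_rpow, ← Real.rpow_mul (by positivity),
        ← Real.rpow_add (by positivity)]
      norm_num
    rw [hgap, hquart] at h1
    set L := Real.log T
    set A := √(risk ν wstar)
    set G := ρ ^ (-(1 / 2) : ℝ) * √(meanGap ν)
    have hA : 0 ≤ A := Real.sqrt_nonneg _
    have hG : 0 ≤ G := by positivity
    have hV : 0 ≤ √(varMax ν) := Real.sqrt_nonneg _
    rw [min_def]
    split_ifs
    · have h3 : 51 * (d : ℝ) ^ 2 * ((2 * A + G + 2 * ρ) * (2 * √T) +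
          4 * ((T : ℝ) ^ (-(1 / 4) : ℝ) * √T) + 1 / ρ * (1 + L)) ≤
          L * ((4 * A + 4 * G + 4 * ρ) * √T +
          4 * ((T : ℝ) ^ (-(1 / 4) : ℝ) * (ρ ^ (-(1 / 2) : ℝ) + 1) * √T) + 1 / ρ * (4 * L)) := by
        have : (T : ℝ) ^ (-(1 / 4) : ℝ) ≤
          (T : ℝ) ^ (-(1 / 4) : ℝ) * (ρ ^ (-(1 / 2) : ℝ) + 1) := by nlinarith
        have h5 : (2 * A + G + 2 * ρ) * (2 * √T) ≤ (4 * A + 4 * G + 4 * ρ) * √T := by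
          nlinarith [mul_nonneg hG hs.le]
        gcongr
        linarith
      have e2 : L / (ρ * √T) * √T = 1 / ρ * L := by
        rw [div_mul_eq_mul_div, mul_div_mul_right _ _ hs.ne', div_eq_mul_one_div, mul_comm]
      have e3 : 4 * ((A + G + ((T : ℝ) ^ (-(1 / 4) : ℝ) * (ρ ^ (-(1 / 2) : ℝ) + 1)
          + L / (ρ * √T)) + ρ) * L * √T) = L * ((4 * A + 4 * G + 4 * ρ) * √T +
          4 * ((T : ℝ) ^ (-(1 / 4) : ℝ) * (ρ ^ (-(1 / 2) : ℝ) + 1) * √T)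
            + 4 * (L / (ρ * √T) * √T)) := by ring
      rw [e3, e2]
      linarith
    · have h3 : 51 * (d : ℝ) ^ 2 * ((2 * √(varMax ν) + 2 * ρ) * (2 * √T)) ≤
          L * ((2 * √(varMax ν) + 2 * ρ) * (2 * √T)) := by gcongr
      linarith
  · have h1 := expectedRegret_le_mul_maxRegret (P := P) hd hstar hM T
    have h2 : (T : ℝ) ≤ Real.exp (51 * (d : ℝ) ^ 2) := by
      rw [← Real.log_le_iff_le_exp (by positivity)]
      exact (not_le.1 hL).le
    have h3 := mul_le_mul_of_nonneg_right h2 hΔ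
    have h4 : 0 ≤ 4 * ((min (√(risk ν wstar) + ρ ^ (-(1 / 2) : ℝ) * √(meanGap ν)
              + ((T : ℝ) ^ (-(1 / 4) : ℝ) * (ρ ^ (-(1 / 2) : ℝ) + 1)
                + Real.log T / (ρ * √T)))
            (√(varMax ν)) + ρ) * Real.log T * √T) := by positivity
    linarith

open Filter Topology in
theorem eventually_lowerOrder_le {ρ : ℝ} (hρ : 0 < ρ) (B : ℝ) :
    ∀ᶠ T : ℕ in atTop, 1 ≤ T ∧
      (T : ℝ) ^ (-(1 / 4) : ℝ) * (ρ ^ (-(1 / 2) : ℝ) + 1) + Real.log T / (ρ * √T) ≤ ρ ∧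
      B ≤ ρ * Real.log T * √T := by
  have h1 : Tendsto (fun x : ℝ => x ^ (-(1 / 4) : ℝ) * (ρ ^ (-(1 / 2) : ℝ) + 1)) atTop (𝓝 0) := by
    simpa using (tendsto_rpow_neg_atTop (by norm_num : (0 : ℝ) < 1 / 4)).mul_const
      (ρ ^ (-(1 / 2) : ℝ) + 1)
  have h2 : Tendsto (fun x : ℝ => Real.log x / (ρ * √x)) atTop (𝓝 0) := by
    have h := ((isLittleO_log_rpow_atTop
      (by norm_num : (0 : ℝ) < 1 / 2)).tendsto_div_nhds_zero).const_mul (1 / ρ)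
    rw [mul_zero] at h
    refine h.congr fun x => ?_
    rw [Real.sqrt_eq_rpow]
    ring
  have h3 : Tendsto (fun x : ℝ => ρ * Real.log x * √x) atTop atTop :=
    (Real.tendsto_log_atTop.const_mul_atTop hρ).atTop_mul_atTop₀ Real.tendsto_sqrt_atTop
  have h12 := h1.add h2
  rw [add_zero] at h12
  refine (eventually_ge_atTop 1).and (Eventually.and ?_ ?_)
  · exact (h12.comp tendsto_natCast_atTop_atTop).eventually_le_const hρ
  · exact (h3.comp tendsto_natCast_atTop_atTop).eventually_ge_atTop B

end CMCB

theorem theorem1 :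
    ∃ C : ℝ, 0 < C ∧
      -- the bound, once the horizon exceeds a threshold depending only on `d`, `ρ` and a bound
      -- `G` on the gap between the largest and the smallest mean
      (∀ (d : ℕ), 1 ≤ d → ∀ (ρ : ℝ), 0 < ρ → ∀ (G : ℝ), ∃ T₀ : ℕ,
        ∀ (ν : Measure (Fin d → ℝ)), CMCB.IsRewardLaw ν → CMCB.meanGap ν ≤ G →
        ∀ (wstar : Fin d → ℝ), CMCB.IsArgmax (CMCB.mean ν) (CMCB.covMat ν) ρ wstar →
        ∀ (Ω : Type u) [MeasurableSpace Ω] (P : Measure Ω) [IsProbabilityMeasure P]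
          (θ w : ℕ → Ω → Fin d → ℝ),
          CMCB.IsEnvironment P ν θ → CMCB.IsMCEmpirical ρ θ w →
        ∀ T : ℕ, T₀ ≤ T →
          CMCB.expectedRegret P ν ρ wstar w T ≤
            C * ((min (√(CMCB.risk ν wstar) + ρ ^ (-(1 / 2) : ℝ) * √(CMCB.meanGap ν))
                  (√(CMCB.varMax ν)) + ρ) * Real.log T * √T)) ∧
      -- the bound for every horizon, with its lower-order terms written out
      (∃ K : ℕ → ℝ, ∀ (d : ℕ), 1 ≤ d → ∀ (ρ : ℝ), 0 < ρ →
        ∀ (ν : Measure (Fin d → ℝ)), CMCB.IsRewardLaw ν →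
        ∀ (wstar : Fin d → ℝ), CMCB.IsArgmax (CMCB.mean ν) (CMCB.covMat ν) ρ wstar →
        ∀ (Ω : Type u) [MeasurableSpace Ω] (P : Measure Ω) [IsProbabilityMeasure P]
          (θ w : ℕ → Ω → Fin d → ℝ),
          CMCB.IsEnvironment P ν θ → CMCB.IsMCEmpirical ρ θ w →
        ∀ T : ℕ, 1 ≤ T →
          CMCB.expectedRegret P ν ρ wstar w T ≤
            C * ((min (√(CMCB.risk ν wstar) + ρ ^ (-(1 / 2) : ℝ) * √(CMCB.meanGap ν)
                    + ((T : ℝ) ^ (-(1 / 4) : ℝ) * (ρ ^ (-(1 / 2) : ℝ) + 1)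
                      + Real.log T / (ρ * √T)))
                  (√(CMCB.varMax ν)) + ρ) * Real.log T * √T)
              + K d * CMCB.maxRegret ν ρ wstar) := by
  refine ⟨12, by norm_num, ?_, fun d => Real.exp (51 * (d : ℝ) ^ 2) + 1, ?_⟩
  · intro d hd ρ hρ G
    obtain ⟨T₀, hT₀⟩ := Filter.eventually_atTop.1 (CMCB.eventually_lowerOrder_le hρ
      ((Real.exp (51 * (d : ℝ) ^ 2) + 1) * (G + ρ)))
    refine ⟨T₀, fun ν hν hG wstar hstar Ω _ P _ θ w hE hM T hT => ?_⟩
    obtain ⟨hT1, hε, hB⟩ := hT₀ T hT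
    have h := CMCB.expectedRegret_le_add_maxRegret hν hd hρ hstar hE hM hT1
    have hT1' : (1 : ℝ) ≤ T := by exact_mod_cast hT1
    have hΔ : (Real.exp (51 * (d : ℝ) ^ 2) + 1) * CMCB.maxRegret ν ρ wstar ≤
        (Real.exp (51 * (d : ℝ) ^ 2) + 1) * (G + ρ) := by
      gcongr
      exact (CMCB.maxRegret_le hν hd hρ hstar.1).trans (by linarith)
    have hX : 0 ≤ Real.log T * √T := mul_nonneg (Real.log_nonneg hT1') (Real.sqrt_nonneg _)
    set A := √(CMCB.risk ν wstar) + ρ ^ (-(1 / 2) : ℝ) * √(CMCB.meanGap ν)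
    set V := √(CMCB.varMax ν)
    set ε := (T : ℝ) ^ (-(1 / 4) : ℝ) * (ρ ^ (-(1 / 2) : ℝ) + 1) + Real.log T / (ρ * √T)
    have hA : 0 ≤ A := by positivity
    have hm0 : 0 ≤ min A V := le_min hA (Real.sqrt_nonneg _)
    have hmin : min (A + ε) V ≤ min A V + ρ := by
      rw [← min_add_add_right]
      exact min_le_min (by linarith) (by linarith)
    have h1 := mul_le_mul_of_nonneg_right hmin hX
    have h2 := mul_nonneg hm0 hX
    have h3 := mul_nonneg hρ.le hX
    linarith
  · intro d hd ρ hρ ν hν wstar hstar Ω _ P _ θ w hE hM T hT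
    refine (CMCB.expectedRegret_le_add_maxRegret hν hd hρ hstar hE hM hT).trans ?_
    have hT1 : (1 : ℝ) ≤ T := by exact_mod_cast hT
    have hL0 : 0 ≤ Real.log T := Real.log_nonneg hT1
    gcongr
    norm_num
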